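/- Let $n\ge 0$, let $\mathfrak M$ be a compact connected (non-empty) metric space and let $\mathfrak X$ be a compact metric space. A *foliation chart* on $\mathfrak M$ is a homeomorphism $\varphi=(\lambda,\pi)\colon \overline U\to[-1,1]^n\times\mathfrak T$, where $\overline U\subset\mathfrak M$ is the closure of its interior $U$, $\mathfrak T\subset\mathfrak X$ is compact, and $U=\varphi^{-1}\big((-1,1)^n\times \mathrm{int}\,\mathfrak T\big)$ (the interior of $\mathfrak T$ is taken in $\mathfrak X$); the sets $\pi^{-1}(w)\subset\overline U$, $w\in\mathfrak T$, are its *plaques*. Two charts $\varphi,\psi$ are *compatible* if on the overlap $U_\varphi\cap U_\psi$ the plaques of each are locally contained in plaques of the other, and both changes of leaf coordinates $v\mapsto\lambda_\psi(\varphi^{-1}(v,w))$ and $v\mapsto\lambda_\varphi(\psi^{-1}(v,w))$ are $C^\infty$ in $v$, with all derivatives in $v$ continuous on the overlap. An *$n$-dimensional matchbox manifold* structure on $\mathfrak M$ is a choice, for each $x\in\mathfrak M$, of a foliation chart $\varphi_x$ with $x\in U_x$ and $\lambda_x(x)=0$ whose model $\mathfrak T_x$ is totally disconnected, any two of these charts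 being compatible. A *chart of $\mathfrak M$* is a foliation chart compatible with all the $\varphi_x$. A *regular covering* of $\mathfrak M$ is a finite family of charts $\varphi_i\colon\overline U_i\to[-1,1]^n\times\mathfrak T_i$ of $\mathfrak M$ such that the $U_i$ cover $\mathfrak M$ and, whenever $U_i\cap U_j\neq\emptyset$, the set $\overline U_i\cup\overline U_j$ is contained in the open part $\widehat U$ of some chart of $\mathfrak M$, each plaque of which meets $\overline U_i$ in at most one plaque of $\varphi_i$, and $\overline U_j$ in at most one plaque of $\varphi_j$. There is then a well-defined map $h_{j,i}\colon\pi_i(U_i\cap U_j)\to\pi_j(U_i\cap U_j)$ with $h_{j,i}(\pi_i(z))=\pi_j(z)$ for $z\in U_i\cap U_j$. Let $\mathcal G^*$ be the set of all restrictions, to open subsets of their maximal domains, of the compositions $h_{i_\alpha,i_{\alpha-1}}\circ\cdots\circ h_{i_1,i_0}$ (including the identity of $\pi_i(U_i)$ for each $i$). The holonomy pseudogroup of the covering is *equicontinuous* if for every $\epsilon>0$ there is $\delta>0$ such that for all $g\in\mathcal G^*$ and all $w,w'$ in the domain of $g$ with $d_{\mathfrak X}(w,w')<\delta$ one has $d_{\mathfrak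 X}(g(w),g(w'))<\epsilon$. The matchbox manifold $\mathfrak M$ is *equicontinuous* if the holonomy pseudogroup of some regular covering of $\mathfrak M$ is equicontinuous. **Theorem.** Let $\mathfrak M$ be a matchbox manifold that is homogeneous: for all $x,y\in\mathfrak M$ there is a homeomorphism $h\colon\mathfrak M\to\mathfrak M$ with $h(x)=y$. Then $\mathfrak M$ is equicontinuous. Moreover, for every $\eta>0$ there is a regular covering of $\mathfrak M$ each of whose charts is centred at a point $x_i\in U_i$ (that is, $\lambda_i(x_i)=0$) and satisfies $\overline U_i\subset B(x_i,\eta)$; and the holonomy pseudogroup of every regular covering of $\mathfrak M$ is equicontinuous. -/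

import Mathlib

open Set Filter Topology
open scoped ContDiff

namespace Matchbox

/-- A foliation chart `φ : Ū → [-1,1]^n × 𝔗` on a space `M`, with transverse model `𝔗` a compact
subset of `X`.  `φ` is a homeomorphism from `Ū = source` onto `[-1,1]^n × 𝔗 = target`; its values
off `Ū` (and those of its inverse off `[-1,1]^n × 𝔗`) play no role.
The last two fields say that the interior of `Ū` is
`U = φ⁻¹((-1,1)^n × int 𝔗)`, with `int 𝔗` taken in `X`, and that `Ū` is the closure of `U`. -/
structure FoliationChart (n : ℕ) (M X : Type*) [TopologicalSpace M] [TopologicalSpace X]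
    extends PartialEquiv M ((Fin n → ℝ) × X) where
  /-- the transverse model `𝔗` -/
  model : Set X
  isCompact_model : IsCompact model
  target_eq : target = Icc (-1) 1 ×ˢ model
  continuousOn_toFun : ContinuousOn toFun source
  continuousOn_invFun : ContinuousOn invFun target
  interior_source : interior source =
    source ∩ toFun ⁻¹' ((Set.pi univ fun _ => Ioo (-1) 1) ×ˢ interior model)
  closure_interior : closure (interior source) = source

namespace FoliationChart

variable {n : ℕ} {M X : Type*} [TopologicalSpace M] [TopologicalSpace X]

/-- The open chart `U = int Ū = φ⁻¹((-1,1)^n × int 𝔗)`. -/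
def core (φ : FoliationChart n M X) : Set M := interior φ.source

/-- The leaf coordinate `λ : Ū → [-1,1]^n`. -/
def leafCoord (φ : FoliationChart n M X) (z : M) : Fin n → ℝ := (φ.toFun z).1

/-- The projection `π : Ū → 𝔗`. Its fibres in `Ū` are the (closed) plaques of the chart. -/
def proj (φ : FoliationChart n M X) (z : M) : X := (φ.toFun z).2

/-- The change of leaf coordinates `v ↦ λ_ψ(φ⁻¹(v, w))` along the plaque of `φ` over `w`. -/
def leafTransition (φ ψ : FoliationChart n M X) (w : X) (v : Fin n → ℝ) : Fin n → ℝ :=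
  ψ.leafCoord (φ.invFun (v, w))

/-- Plaques of `φ` are locally contained in plaques of `ψ`, on the overlap of the open charts.
Imposed for `(φ, ψ)` and `(ψ, φ)`, this says that the intersection of the interiors of
the two plaques through a point of the overlap is open in both of them. -/
def PlaqueCompatible (φ ψ : FoliationChart n M X) : Prop :=
  ∀ z ∈ φ.core ∩ ψ.core, ∀ᶠ z' in 𝓝 z, φ.proj z' = φ.proj z → ψ.proj z' = ψ.proj z

/-- The change of coordinates from `φ` to `ψ` maps plaques to plaques, is smooth along the
plaques, and all its leafwise derivatives are continuous on the overlap of the open charts, that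
is, it depends continuously on the plaque in the `C^∞` topology. -/
def SmoothCompatible (φ ψ : FoliationChart n M X) : Prop :=
  φ.PlaqueCompatible ψ ∧
  (∀ z ∈ φ.core ∩ ψ.core, ContDiffAt ℝ ∞ (φ.leafTransition ψ (φ.proj z)) (φ.leafCoord z)) ∧
  ∀ k : ℕ, ContinuousOn
    (fun z => iteratedFDeriv ℝ k (φ.leafTransition ψ (φ.proj z)) (φ.leafCoord z))
    (φ.core ∩ ψ.core)

end FoliationChart

/-- The structure of an `n`-dimensional matchbox manifold on a space `M` (in the theorem, a
continuum): a smooth foliated atlas, with a chart centred at each point, whose transverse models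
are totally disconnected compact subsets of the compact metric space `X`. -/
structure MatchboxManifold (n : ℕ) (M X : Type*) [TopologicalSpace M] [TopologicalSpace X] where
  chart : M → FoliationChart n M X
  mem_core : ∀ x, x ∈ (chart x).core
  leafCoord_center : ∀ x, (chart x).leafCoord x = 0
  compatible : ∀ x y, (chart x).SmoothCompatible (chart y)
  totallyDisconnected : ∀ x, IsTotallyDisconnected (chart x).model

/-- A chart of the smooth foliated space `𝔐`: one which is smoothly compatible with its atlas. -/
def MatchboxManifold.IsChart {n : ℕ} {M X : Type*} [TopologicalSpace M] [TopologicalSpace X]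
    (𝔐 : MatchboxManifold n M X) (φ : FoliationChart n M X) : Prop :=
  ∀ x, (𝔐.chart x).SmoothCompatible φ ∧ φ.SmoothCompatible (𝔐.chart x)

/-- A regular covering of `𝔐`: finitely many charts whose open parts `U_i` cover `M`, such that
for `U_i ∩ U_j ≠ ∅` the union `Ū_i ∪ Ū_j` lies in the open part of one chart of `𝔐`, each plaque
of which meets each of `Ū_i`, `Ū_j` in at most one plaque. -/
structure RegularCovering {n : ℕ} {M X : Type*} [TopologicalSpace M] [TopologicalSpace X]
    (𝔐 : MatchboxManifold n M X) where
  /-- the number of charts -/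
  card : ℕ
  chart : Fin card → FoliationChart n M X
  isChart : ∀ i, 𝔐.IsChart (chart i)
  cover : ∀ z, ∃ i, z ∈ (chart i).core
  regular : ∀ i j, ((chart i).core ∩ (chart j).core).Nonempty →
    ∃ ψ : FoliationChart n M X, 𝔐.IsChart ψ ∧
      (chart i).source ∪ (chart j).source ⊆ ψ.core ∧
      (∀ a ∈ (chart i).source, ∀ b ∈ (chart i).source,
        ψ.proj a = ψ.proj b → (chart i).proj a = (chart i).proj b) ∧
      (∀ a ∈ (chart j).source, ∀ b ∈ (chart j).source,
        ψ.proj a = ψ.proj b → (chart j).proj a = (chart j).proj b)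

namespace RegularCovering

section Topological

variable {n : ℕ} {M X : Type*} [TopologicalSpace M] [TopologicalSpace X]
  {𝔐 : MatchboxManifold n M X}

/-- `𝔇_{i,j} = π_i(U_i ∩ U_j)`, the domain of `h_{j,i}`. -/
def transDomain (C : RegularCovering 𝔐) (i j : Fin C.card) : Set X :=
  (C.chart i).proj '' ((C.chart i).core ∩ (C.chart j).core)

open Classical in
/-- The transverse change of coordinates `h_{j,i} : 𝔇_{i,j} → 𝔇_{j,i}`, taking the plaque of `U_i`
through `z ∈ U_i ∩ U_j` to the plaque of `U_j` through `z` (see `transMap_proj`); the value off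
`𝔇_{i,j}` plays no role. -/
noncomputable def transMap (C : RegularCovering 𝔐) (i j : Fin C.card) (w : X) : X :=
  if h : ∃ z ∈ (C.chart i).core ∩ (C.chart j).core, (C.chart i).proj z = w
  then (C.chart j).proj h.choose else w

/-- `h_{j,i}` is well defined. -/
theorem transMap_proj (C : RegularCovering 𝔐) {i j : Fin C.card} {z : M}
    (hz : z ∈ (C.chart i).core ∩ (C.chart j).core) :
    C.transMap i j ((C.chart i).proj z) = (C.chart j).proj z := by
  have hex : ∃ y ∈ (C.chart i).core ∩ (C.chart j).core,
      (C.chart i).proj y = (C.chart i).proj z := ⟨z, hz, rfl⟩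
  rw [transMap, dif_pos hex]
  obtain ⟨hy, hyz⟩ := hex.choose_spec
  generalize hex.choose = y at hy hyz
  obtain ⟨ψ, hψ, hsub, -, hinj⟩ := C.regular i j ⟨z, hz⟩
  refine hinj y (interior_subset hy.2) z (interior_subset hz.2) ?_
  set φ := C.chart i with hφ
  have hφc := C.isChart i
  have hcore : ∀ a ∈ φ.core, a ∈ φ.source ∧
      φ.leafCoord a ∈ (Set.pi univ fun _ : Fin n => Ioo (-1 : ℝ) 1) ∧
      φ.proj a ∈ interior φ.model := by
    intro a ha
    rw [FoliationChart.core, φ.interior_source] at ha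
    exact ⟨ha.1, ha.2.1, ha.2.2⟩
  set w := φ.proj z with hw
  set B : Set (Fin n → ℝ) := Set.pi univ fun _ : Fin n => Ioo (-1 : ℝ) 1 with hB
  have hBc : IsPreconnected B := (convex_pi fun _ _ => convex_Ioo _ _).isPreconnected
  have hwm : w ∈ interior φ.model := (hcore z hz.1).2.2
  have hT : ∀ v ∈ B, (v, w) ∈ φ.target := by
    intro v hv
    rw [φ.target_eq]
    exact ⟨⟨fun k => (hv k trivial).1.le, fun k => (hv k trivial).2.le⟩, interior_subset hwm⟩
  have hinv : ∀ v ∈ B, φ.toFun (φ.invFun (v, w)) = (v, w) := fun v hv => φ.right_inv' (hT v hv)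
  have hpr : ∀ v ∈ B, φ.proj (φ.invFun (v, w)) = w := fun v hv => by
    rw [FoliationChart.proj, hinv v hv]
  have hc : ∀ v ∈ B, φ.invFun (v, w) ∈ φ.core := by
    intro v hv
    rw [FoliationChart.core, φ.interior_source]
    exact ⟨φ.map_target' (hT v hv), by rw [mem_preimage, hinv v hv]; exact ⟨hv, hwm⟩⟩
  have hcont : ContinuousOn (fun v => φ.invFun (v, w)) B :=
    φ.continuousOn_invFun.comp (by fun_prop) hT
  have hconst : ∀ {u v}, u ∈ B → v ∈ B →
      ψ.proj (φ.invFun (u, w)) = ψ.proj (φ.invFun (v, w)) := hBc.induction₂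
    (fun u v => ψ.proj (φ.invFun (u, w)) = ψ.proj (φ.invFun (v, w)))
    (by
      intro v hv
      set p := φ.invFun (v, w) with hp
      have hpψ : p ∈ ψ.core := hsub (Or.inl (interior_subset (hc v hv)))
      have h1 := (hφc p).2.1 p ⟨hc v hv, 𝔐.mem_core p⟩
      have h2 := (hψ p).1.1 p ⟨𝔐.mem_core p, hpψ⟩
      have h3 := (hcont v hv).eventually (h1.and h2)
      filter_upwards [h3, self_mem_nhdsWithin] with u hu huB
      exact (hu.2 (hu.1 (by rw [hpr u huB, hp, hpr v hv]))).symm)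
    (fun _ _ _ _ _ _ h h' => h.trans h')
    (fun _ _ _ _ h => h.symm)
  have hval : ∀ a ∈ φ.core, φ.proj a = w → φ.invFun (φ.leafCoord a, w) = a := by
    intro a ha haw
    have : (φ.leafCoord a, w) = φ.toFun a := by rw [← haw]; rfl
    rw [this]
    exact φ.left_inv' (hcore a ha).1
  have := hconst (hcore y hy.1).2.1 (hcore z hz.1).2.1
  simpa only [hval y hy.1 hyz, hval z hz.1 rfl] using this

/-- The composition `h_I = h_{i_α, i_{α-1}} ∘ ⋯ ∘ h_{i_1, i_0}` for `I = (i_0, i_1, …, i_α)`. -/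
noncomputable def chainMap (C : RegularCovering 𝔐) : Fin C.card → List (Fin C.card) → X → X
  | _, [], w => w
  | i, j :: l, w => chainMap C j l (C.transMap i j w)

/-- The domain of `h_I`: the largest subset of `𝔇_{i_0,i_1}` on which the composition is
defined (for `I = (i_0)`, `h_I` is the identity of `𝔇_{i_0,i_0} = π_{i_0}(U_{i_0})`). -/
def chainDomain (C : RegularCovering 𝔐) : Fin C.card → List (Fin C.card) → Set X
  | i, [] => C.transDomain i i
  | i, j :: l => {w ∈ C.transDomain i j | C.transMap i j w ∈ chainDomain C j l}

/-- The collection `𝒢* = {h_I | U}` of all restrictions of the maps `h_I` to open subsets `U` of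
their domains, as partial maps of `X`. -/
def holonomy (C : RegularCovering 𝔐) : Set (X →. X) :=
  {g | ∃ (i : Fin C.card) (l : List (Fin C.card)) (U : Set X), IsOpen U ∧ U ⊆ C.chainDomain i l ∧
    g = fun w => ⟨w ∈ U, fun _ => C.chainMap i l w⟩}

end Topological

section Metric

variable {n : ℕ} {M X : Type*} [MetricSpace M] [MetricSpace X] {𝔐 : MatchboxManifold n M X}

/-- The holonomy pseudogroup of the covering is equicontinuous. -/
def IsEquicontinuous (C : RegularCovering 𝔐) : Prop :=
  ∀ ε > 0, ∃ δ > 0, ∀ g ∈ C.holonomy, ∀ (w w' : X) (hw : w ∈ g.Dom) (hw' : w' ∈ g.Dom),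
    dist w w' < δ → dist (g.fn w hw) (g.fn w' hw') < ε

/-- Each chart is centred at a point `x_i`, and its closed domain lies in the `η`-ball at `x_i`. -/
def IsLocal (C : RegularCovering 𝔐) (η : ℝ) : Prop :=
  ∀ i, ∃ x ∈ (C.chart i).core, (C.chart i).leafCoord x = 0 ∧
    (C.chart i).source ⊆ Metric.ball x η

end Metric

end RegularCovering

/-- `𝔐` is equicontinuous: the holonomy pseudogroup of some regular covering is. -/
def MatchboxManifold.IsEquicontinuous {n : ℕ} {M X : Type*} [MetricSpace M] [MetricSpace X]
    (𝔐 : MatchboxManifold n M X) : Prop :=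
  ∃ C : RegularCovering 𝔐, C.IsEquicontinuous

/-- A space is homogeneous if its homeomorphisms act transitively on it. -/
def IsHomogeneousSpace (M : Type*) [TopologicalSpace M] : Prop :=
  ∀ x y : M, ∃ h : M ≃ₜ M, h x = y

end Matchbox

/-! ### Effros' theorem: Baire category and back-and-forth -/

namespace Homeomorph

/-! Homogeneity becomes uniform through Effros' theorem (`Homeomorph.exists_apply_eq_of_dist_lt`):
sufficiently close points are exchanged by a homeomorphism `h` of small displacement. Such an `h`
respects plaques, since the transverse coordinate is constant along connected leafwise pieces
(`IsChart.proj_comp_eq`).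

Given close `w`, `w'`, let `h` carry the centre of one plaque to the centre of the other. Along any
chain of charts, the same `h` sends each successive plaque of the first orbit into a plaque of the
enlarged chart containing the corresponding plaque of the second. Their transverse distance is
therefore bounded by the displacement of `h` alone, however long the chain, and no error
accumulates. This is `isEquicontinuous_of_isHomogeneousSpace`. Regular coverings exist by a Lebesgue
number argument applied to rescaled atlas charts (`exists_regularCovering_isLocal`). -/

/-- The part of the orbit of `x` reached by homeomorphisms that are `ε`-close to the identity. -/
def smallOrbit {M : Type*} [MetricSpace M] (ε : ℝ) (x : M) : Set M :=
  {y | ∃ h : M ≃ₜ M, (∀ z, dist (h z) z < ε) ∧ h x = y}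

variable {M : Type*} [MetricSpace M]

theorem dist_symm_lt {ε : ℝ} {h : M ≃ₜ M} (hh : ∀ z, dist (h z) z < ε) (z : M) :
    dist (h.symm z) z < ε := by
  have := hh (h.symm z)
  rwa [h.apply_symm_apply, dist_comm] at this

/-- A sequence of homeomorphisms which, together with the inverses, is uniformly fast Cauchy,
converges to a homeomorphism. -/
theorem exists_tendsto_of_le_geometric [CompleteSpace M] {C : ℝ} {g : ℕ → M ≃ₜ M}
    (hg : ∀ n z, dist (g n z) (g (n + 1) z) ≤ C / 2 / 2 ^ n)
    (hg' : ∀ n z, dist ((g n).symm z) ((g (n + 1)).symm z) ≤ C / 2 / 2 ^ n) :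
    ∃ G : M ≃ₜ M, ∀ z, Tendsto (fun n => g n z) atTop (𝓝 (G z)) := by
  have key : ∀ f : ℕ → M ≃ₜ M, (∀ n z, dist (f n z) (f (n + 1) z) ≤ C / 2 / 2 ^ n) →
      ∃ F : M → M, TendstoUniformly (fun n z => f n z) F atTop := by
    intro f hf
    choose F hF using fun z => cauchySeq_tendsto_of_complete
      (cauchySeq_of_le_geometric_two (f := fun n => f n z) fun n => hf n z)
    refine ⟨F, Metric.tendstoUniformly_iff.2 fun ε hε => ?_⟩
    have h0 : Tendsto (fun n : ℕ => C / 2 ^ n) atTop (𝓝 0) := by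
      have := (tendsto_pow_atTop_nhds_zero_of_lt_one (r := (1 / 2 : ℝ)) (by norm_num)
        (by norm_num)).const_mul C
      simpa [div_eq_mul_inv] using this
    filter_upwards [h0.eventually_lt_const hε] with n hn z
    rw [dist_comm]
    exact (dist_le_of_le_geometric_two_of_tendsto (f := fun n => f n z) (fun n => hf n z)
      (hF z) n).trans_lt hn
  obtain ⟨F, hF⟩ := key g hg
  obtain ⟨F', hF'⟩ := key (fun n => (g n).symm) hg'
  have cF : Continuous F := hF.continuous (Frequently.of_forall fun n => (g n).continuous)
  have cF' : Continuous F' := hF'.continuous (Frequently.of_forall fun n => (g n).symm.continuous)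
  refine ⟨⟨⟨F, F', fun z => ?_, fun z => ?_⟩, cF, cF'⟩, fun z => hF.tendsto_at z⟩
  -- Uniform convergence allows passing to the limit in `(g n).symm (g n z) = z`.
  · have := hF'.tendsto_comp cF'.continuousAt (hF.tendsto_at z)
    simp only [symm_apply_apply] at this
    exact (tendsto_nhds_unique this tendsto_const_nhds)
  · have := hF.tendsto_comp cF.continuousAt (hF'.tendsto_at z)
    simp only [apply_symm_apply] at this
    exact (tendsto_nhds_unique this tendsto_const_nhds)

variable [CompactSpace M]

/-- The homeomorphisms of a compact metric space are separable for the uniform distance. -/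
theorem exists_countable_uniformly_dense {ε : ℝ} (hε : 0 < ε) :
    ∃ D : Set (M ≃ₜ M), D.Countable ∧ ∀ g : M ≃ₜ M, ∃ d ∈ D, ∀ z, dist (d z) (g z) < ε := by
  let F : (M ≃ₜ M) → C(M, M) := fun g => ⟨g, g.continuous⟩
  -- Density is taken inside the range of `F`, so that the approximants are themselves
  -- homeomorphisms.
  obtain ⟨D, hDc, hD⟩ := TopologicalSpace.exists_countable_dense (Set.range F)
  choose G hG using fun a : Set.range F => a.2
  refine ⟨G '' D, hDc.image G, fun g => ?_⟩
  obtain ⟨d, hd, hdist⟩ := hD.exists_dist_lt ⟨F g, g, rfl⟩ hε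
  refine ⟨G d, ⟨d, hd, rfl⟩, fun z => ?_⟩
  have h1 : dist (F g) (F (G d)) < ε := by rw [hG d]; exact hdist
  have h2 := (ContinuousMap.dist_lt_iff hε).1 h1 z
  rw [dist_comm]
  exact h2

/-- Baire category. If `g x = y` and `d` is close to `g⁻¹`, then `d ∘ g` is close to the identity
and sends `x` to `d y`; hence countably many translates of one closed set cover `M`. -/
theorem interior_closure_smallOrbit_nonempty (hM : Matchbox.IsHomogeneousSpace M) {ε : ℝ}
    (hε : 0 < ε) (x : M) : (interior (closure (smallOrbit ε x))).Nonempty := by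
  have : Nonempty M := ⟨x⟩
  obtain ⟨D, hDc, hD⟩ := exists_countable_uniformly_dense (M := M) hε
  have := hDc.to_subtype
  have hcov : ⋃ d : D, (d : M ≃ₜ M).symm '' closure (smallOrbit ε x) = univ := by
    refine eq_univ_of_forall fun y => ?_
    obtain ⟨g, hg⟩ := hM x y
    obtain ⟨d, hd, hdg⟩ := hD g.symm
    refine mem_iUnion.2 ⟨⟨d, hd⟩, d y, subset_closure ⟨g.trans d, fun z => ?_, ?_⟩, ?_⟩
    · simpa using hdg (g z)
    · simp [hg]
    · simp
  obtain ⟨d, hd⟩ := nonempty_interior_of_iUnion_of_closed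
    (fun d : D => (d : M ≃ₜ M).symm.isClosedMap _ isClosed_closure) hcov
  rw [← Homeomorph.image_interior] at hd
  exact hd.of_image

/-- The orbit maps of a homogeneous compact metric space are nearly open. -/
theorem mem_interior_closure_smallOrbit (hM : Matchbox.IsHomogeneousSpace M) {ε : ℝ}
    (hε : 0 < ε) (x : M) : x ∈ interior (closure (smallOrbit ε x)) := by
  obtain ⟨p, hp⟩ := interior_closure_smallOrbit_nonempty hM (half_pos hε) x
  -- The open set contains some `n x` with `n` close to the identity; pulling back by `n⁻¹` moves it
  -- around `x`.
  obtain ⟨q, hq, n, hn, rfl⟩ := mem_closure_iff.1 (interior_subset hp) _ isOpen_interior hp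
  have h1 : x ∈ n.symm '' interior (closure (smallOrbit (ε / 2) x)) := ⟨n x, hq, by simp⟩
  rw [Homeomorph.image_interior, Homeomorph.image_closure] at h1
  refine interior_mono (closure_mono ?_) h1
  rintro _ ⟨_, ⟨m, hm, rfl⟩, rfl⟩
  refine ⟨m.trans n.symm, fun z => ?_, rfl⟩
  calc dist (n.symm (m z)) z ≤ dist (n.symm (m z)) (m z) + dist (m z) z := dist_triangle _ _ _
    _ < ε / 2 + ε / 2 := add_lt_add (dist_symm_lt hn _) (hm z)
    _ = ε := add_halves ε

/-- Composing with a homeomorphism close to the identity moves `g` and `g⁻¹` little. -/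
theorem exists_modulus (g : M ≃ₜ M) {c : ℝ} (hc : 0 < c) :
    ∃ ε > 0, ∀ u : M ≃ₜ M, (∀ z, dist (u z) z < ε) →
      (∀ z, dist (g z) ((g.trans u) z) ≤ c) ∧
        ∀ z, dist (g.symm z) ((g.trans u).symm z) ≤ c := by
  have huc := CompactSpace.uniformContinuous_of_continuous g.symm.continuous
  obtain ⟨δ, hδ, h⟩ := Metric.uniformContinuous_iff.1 huc c hc
  refine ⟨min δ c, lt_min hδ hc, fun u hu => ⟨fun z => ?_, fun z => ?_⟩⟩
  · rw [dist_comm]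
    exact ((hu (g z)).trans_le (min_le_right _ _)).le
  · refine (h ?_).le
    rw [dist_comm]
    exact (dist_symm_lt hu z).trans_le (min_le_left _ _)

/-- Points near `x` are images of `x` under homeomorphisms close to the identity. -/
theorem exists_apply_eq_of_mem_nhds (hM : Matchbox.IsHomogeneousSpace M) {ε : ℝ} (hε : 0 < ε)
    (x : M) : ∀ᶠ y in 𝓝 x, ∃ h : M ≃ₜ M, (∀ z, dist (h z) z ≤ ε) ∧ h x = y := by
  set C := ε / 2 with hC
  have hCpos : 0 < C := half_pos hε
  choose m mpos hm using fun (n : ℕ) (g : M ≃ₜ M) =>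
    exists_modulus g (c := C / 2 / 2 ^ n) (by positivity)
  filter_upwards [isOpen_interior.mem_nhds
    (mem_interior_closure_smallOrbit hM (mpos 0 (Homeomorph.refl M)) x)] with y hy
  -- Back-and-forth: `p.1` moves `x` and `p.2` moves `y`, alternately corrected so that the two
  -- images merge. The tolerance `m` depends on the current homeomorphism, to keep the inverses
  -- Cauchy too.
  let P : ℕ → (M ≃ₜ M) × (M ≃ₜ M) → Prop := fun n p =>
    p.2 y ∈ interior (closure (smallOrbit (m n p.1) (p.1 x)))
  have step : ∀ n p, P n p → ∃ p' : (M ≃ₜ M) × (M ≃ₜ M), P (n + 1) p' ∧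
      dist (p'.2 y) (p'.1 x) < (1 / 2) ^ n ∧
      (∀ z, dist (p.1 z) (p'.1 z) ≤ C / 2 / 2 ^ n) ∧
      (∀ z, dist (p.1.symm z) (p'.1.symm z) ≤ C / 2 / 2 ^ n) ∧
      (∀ z, dist (p.2 z) (p'.2 z) ≤ C / 2 / 2 ^ n) ∧
      (∀ z, dist (p.2.symm z) (p'.2.symm z) ≤ C / 2 / 2 ^ n) := by
    rintro n ⟨g, h⟩ hp
    obtain ⟨_, hq, u, hu, rfl⟩ := mem_closure_iff.1 (interior_subset hp) _ isOpen_interior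
      (mem_interior_closure_smallOrbit hM (mpos n h) (h y))
    obtain ⟨_, hq', v, hv, rfl⟩ := mem_closure_iff.1 (interior_subset hq) _
      (isOpen_interior.inter Metric.isOpen_ball)
      ⟨mem_interior_closure_smallOrbit hM (mpos (n + 1) (g.trans u)) (u (g x)),
        Metric.mem_ball_self (show (0 : ℝ) < (1 / 2) ^ n by positivity)⟩
    exact ⟨(g.trans u, h.trans v), hq'.1, hq'.2, (hm n g u hu).1, (hm n g u hu).2,
      (hm n h v hv).1, (hm n h v hv).2⟩
  choose! s hs using step
  let p : ℕ → (M ≃ₜ M) × (M ≃ₜ M) := fun n =>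
    Nat.rec (Homeomorph.refl M, Homeomorph.refl M) (fun n q => s n q) n
  have hp : ∀ n, P n (p n) := by
    intro n
    induction n with
    | zero => exact hy
    | succ n ih => exact (hs n (p n) ih).1
  have hstep := fun n => (hs n (p n) (hp n)).2
  obtain ⟨G, hG⟩ := exists_tendsto_of_le_geometric (g := fun n => (p n).1)
    (fun n => (hstep n).2.1) (fun n => (hstep n).2.2.1)
  obtain ⟨H, hH⟩ := exists_tendsto_of_le_geometric (g := fun n => (p n).2)
    (fun n => (hstep n).2.2.2.1) (fun n => (hstep n).2.2.2.2)
  have hGd : ∀ z, dist (G z) z ≤ C := fun z => by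
    rw [dist_comm]
    exact dist_le_of_le_geometric_two_of_tendsto₀ (f := fun n => (p n).1 z)
      (fun n => (hstep n).2.1 z) (hG z)
  have hHd : ∀ z, dist (H z) z ≤ C := fun z => by
    rw [dist_comm]
    exact dist_le_of_le_geometric_two_of_tendsto₀ (f := fun n => (p n).2 z)
      (fun n => (hstep n).2.2.2.1 z) (hH z)
  have hGH : H y = G x := by
    have h1 : Tendsto (fun n => dist ((p (n + 1)).2 y) ((p (n + 1)).1 x)) atTop
        (𝓝 (dist (H y) (G x))) :=
      ((tendsto_add_atTop_iff_nat 1).2 (hH y)).dist ((tendsto_add_atTop_iff_nat 1).2 (hG x))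
    have h2 : Tendsto (fun n => dist ((p (n + 1)).2 y) ((p (n + 1)).1 x)) atTop (𝓝 0) :=
      squeeze_zero (fun _ => dist_nonneg) (fun n => (hstep n).1.le)
        (tendsto_pow_atTop_nhds_zero_of_lt_one (by norm_num) (by norm_num))
    exact dist_eq_zero.1 (tendsto_nhds_unique h1 h2)
  -- Each of `G` and `H` moves points by at most `C = ε / 2`.
  refine ⟨G.trans H.symm, fun z => ?_, ?_⟩
  · have h1 := hHd (H.symm (G z))
    rw [apply_symm_apply, dist_comm] at h1
    calc dist (H.symm (G z)) z ≤ dist (H.symm (G z)) (G z) + dist (G z) z := dist_triangle _ _ _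
      _ ≤ C + C := add_le_add h1 (hGd z)
      _ = ε := add_halves ε
  · rw [trans_apply, ← hGH, symm_apply_apply]

/-- **Effros' theorem** for a homogeneous compact metric space: nearby points are exchanged by
homeomorphisms close to the identity. -/
theorem exists_apply_eq_of_dist_lt (hM : Matchbox.IsHomogeneousSpace M) {ε : ℝ} (hε : 0 < ε) :
    ∃ δ > 0, ∀ x y : M, dist x y < δ → ∃ h : M ≃ₜ M, (∀ z, dist (h z) z < ε) ∧ h x = y := by
  have hε3 : 0 < ε / 3 := by positivity
  choose O hO using fun x => eventually_nhds_iff.1 (exists_apply_eq_of_mem_nhds hM hε3 x)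
  obtain ⟨δ, hδ, h⟩ := lebesgue_number_lemma_of_metric (isCompact_univ (X := M))
    (fun x => (hO x).2.1) (fun x _ => mem_iUnion.2 ⟨x, (hO x).2.2⟩)
  refine ⟨δ, hδ, fun x y hxy => ?_⟩
  obtain ⟨c, hc⟩ := h x trivial
  obtain ⟨f, hf, hfx⟩ := (hO c).1 x (hc (Metric.mem_ball_self hδ))
  obtain ⟨g, hg, hgy⟩ := (hO c).1 y (hc (by rwa [Metric.mem_ball, dist_comm]))
  -- Both points are reached from the common centre `c`; two moves of at most `ε / 3` give a strict
  -- bound.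
  refine ⟨f.symm.trans g, fun z => ?_, ?_⟩
  · have h1 := hf (f.symm z)
    rw [apply_symm_apply, dist_comm] at h1
    have h2 := hg (f.symm z)
    have h3 := dist_triangle (g (f.symm z)) (f.symm z) z
    simp only [trans_apply]
    linarith
  · rw [trans_apply, ← hfx, symm_apply_apply, hgy]

end Homeomorph

/-! ### Charts and the rigidity of plaques -/

namespace Matchbox

namespace FoliationChart

section Topological

variable {n : ℕ} {M X : Type*} [TopologicalSpace M] [TopologicalSpace X]

theorem isOpen_core (φ : FoliationChart n M X) : IsOpen φ.core := isOpen_interior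

theorem core_subset (φ : FoliationChart n M X) : φ.core ⊆ φ.source := interior_subset

theorem continuousOn_proj (φ : FoliationChart n M X) : ContinuousOn φ.proj φ.source :=
  continuous_snd.comp_continuousOn φ.continuousOn_toFun

theorem proj_mem_model (φ : FoliationChart n M X) {z : M} (hz : z ∈ φ.source) :
    φ.proj z ∈ φ.model := by
  have h := φ.map_source' hz
  rw [φ.target_eq] at h
  exact h.2

theorem leafCoord_mem_Icc (φ : FoliationChart n M X) {z : M} (hz : z ∈ φ.source) :
    φ.leafCoord z ∈ Icc (-1 : Fin n → ℝ) 1 := by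
  have h := φ.map_source' hz
  rw [φ.target_eq] at h
  exact h.1

theorem invFun_coords (φ : FoliationChart n M X) {z : M} (hz : z ∈ φ.source) :
    φ.invFun (φ.leafCoord z, φ.proj z) = z := φ.left_inv' hz

theorem mem_target (φ : FoliationChart n M X) {v : Fin n → ℝ} {w : X} :
    (v, w) ∈ φ.target ↔ v ∈ Icc (-1) 1 ∧ w ∈ φ.model := by
  rw [φ.target_eq]
  rfl

theorem proj_invFun (φ : FoliationChart n M X) {v : Fin n → ℝ} {w : X}
    (h : (v, w) ∈ φ.target) : φ.proj (φ.invFun (v, w)) = w := congrArg Prod.snd (φ.right_inv' h)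

theorem zero_mem_target (φ : FoliationChart n M X) {w : X} (hw : w ∈ φ.model) :
    ((0 : Fin n → ℝ), w) ∈ φ.target :=
  φ.mem_target.2 ⟨⟨fun _ => by simp, fun _ => by simp⟩, hw⟩

theorem core_eq (φ : FoliationChart n M X) : φ.core =
    φ.source ∩ φ.toFun ⁻¹' ((Set.pi univ fun _ => Ioo (-1) 1) ×ˢ interior φ.model) :=
  φ.interior_source

theorem isCompact_source (φ : FoliationChart n M X) : IsCompact φ.source := by
  have h : φ.invFun '' φ.target = φ.source := φ.symm_image_target_eq_source
  rw [← h]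
  refine IsCompact.image_of_continuousOn ?_ φ.continuousOn_invFun
  rw [φ.target_eq]
  exact isCompact_Icc.prod φ.isCompact_model

/-- The restriction of a foliation chart to its open part. -/
def toOpenPartialHomeomorph (φ : FoliationChart n M X) :
    OpenPartialHomeomorph M ((Fin n → ℝ) × X) where
  toFun := φ.toFun
  invFun := φ.invFun
  source := φ.core
  target := (Set.pi univ fun _ => Ioo (-1) 1) ×ˢ interior φ.model
  map_source' z hz := by
    rw [φ.core_eq] at hz
    exact hz.2
  map_target' p hp := by
    have ht : p ∈ φ.target := by
      rw [φ.target_eq]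
      exact ⟨⟨fun k => (hp.1 k trivial).1.le, fun k => (hp.1 k trivial).2.le⟩,
        interior_subset hp.2⟩
    rw [φ.core_eq]
    refine ⟨φ.map_target' ht, ?_⟩
    rw [mem_preimage, φ.right_inv' ht]
    exact hp
  left_inv' z hz := φ.left_inv' (φ.core_subset hz)
  right_inv' p hp := by
    refine φ.right_inv' ?_
    rw [φ.target_eq]
    exact ⟨⟨fun k => (hp.1 k trivial).1.le, fun k => (hp.1 k trivial).2.le⟩,
      interior_subset hp.2⟩
  continuousOn_toFun := φ.continuousOn_toFun.mono φ.core_subset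
  continuousOn_invFun := by
    refine φ.continuousOn_invFun.mono fun p hp => ?_
    rw [φ.target_eq]
    exact ⟨⟨fun k => (hp.1 k trivial).1.le, fun k => (hp.1 k trivial).2.le⟩,
      interior_subset hp.2⟩
  open_source := φ.isOpen_core
  open_target := (isOpen_set_pi finite_univ fun _ _ => isOpen_Ioo).prod isOpen_interior

end Topological

end FoliationChart

namespace MatchboxManifold

variable {n : ℕ} {M X : Type*} [TopologicalSpace M]

/-- The transverse coordinate is constant along any continuous image of a convex set. -/
theorem IsChart.proj_comp_eq [TopologicalSpace X] {𝔐 : MatchboxManifold n M X}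
    {ψ : FoliationChart n M X} (hψ : 𝔐.IsChart ψ) {S : Set (Fin n → ℝ)} (hS : Convex ℝ S)
    {f : (Fin n → ℝ) → M} (hf : ContinuousOn f S) (hfS : MapsTo f S ψ.core) {u v : Fin n → ℝ}
    (hu : u ∈ S) (hv : v ∈ S) : ψ.proj (f u) = ψ.proj (f v) := by
  refine hS.isPreconnected.induction₂ (fun u v => ψ.proj (f u) = ψ.proj (f v)) ?_
    (fun _ _ _ _ _ _ h h' => h.trans h') (fun _ _ _ _ h => h.symm) hu hv
  intro v hv
  -- The model of `ψ` need not be totally disconnected, so local constancy is proved in an atlas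
  -- chart and transferred by compatibility.
  set χ := 𝔐.chart (f v) with hχ
  have hcore : f v ∈ χ.core := 𝔐.mem_core _
  obtain ⟨r, hr, hball⟩ := Metric.mem_nhdsWithin_iff.1
    ((hf v hv).preimage_mem_nhdsWithin (χ.isOpen_core.mem_nhds hcore))
  have hsub : (χ.proj ∘ f '' (Metric.ball v r ∩ S)).Subsingleton := by
    refine 𝔐.totallyDisconnected (f v) _ ?_ ?_
    · rintro _ ⟨u, hu, rfl⟩
      exact χ.proj_mem_model (χ.core_subset (hball hu))
    · refine (((convex_ball v r).inter hS).isPreconnected).image _ ?_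
      exact χ.continuousOn_proj.comp (hf.mono inter_subset_right)
        fun u hu => χ.core_subset (hball hu)
  have hconst : ∀ᶠ u in 𝓝[S] v, χ.proj (f u) = χ.proj (f v) := by
    filter_upwards [inter_mem_nhdsWithin S (Metric.ball_mem_nhds v hr)] with u hu
    exact hsub ⟨u, hu.symm, rfl⟩ ⟨v, ⟨Metric.mem_ball_self hr, hv⟩, rfl⟩
  have hcompat := (hf v hv).eventually ((hψ (f v)).1.1 (f v) ⟨hcore, hfS hv⟩)
  filter_upwards [hconst, hcompat] with u h1 h2
  exact (h2 h1).symm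

/-- Near a point of two charts, points on a common plaque of one chart lie on a common plaque of
the other. -/
theorem IsChart.exists_nhds_proj_eq [MetricSpace X] {𝔐 : MatchboxManifold n M X}
    {ψ ψ' : FoliationChart n M X} (hψ' : 𝔐.IsChart ψ') {q : M} (hq : q ∈ ψ.core)
    (hq' : q ∈ ψ'.core) :
    ∃ V ∈ 𝓝 q, ∀ a ∈ V, ∀ b ∈ V, ψ.proj a = ψ.proj b → ψ'.proj a = ψ'.proj b := by
  set e := ψ.toOpenPartialHomeomorph with he
  have hW : IsOpen (e.symm.source ∩ e.symm ⁻¹' ψ'.core) :=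
    e.symm.isOpen_inter_preimage ψ'.isOpen_core
  have hqW : e q ∈ e.symm.source ∩ e.symm ⁻¹' ψ'.core := by
    refine ⟨e.map_source hq, ?_⟩
    rw [mem_preimage, e.left_inv hq]
    exact hq'
  -- The sup metric makes this ball a product, so its plaque slices are convex.
  obtain ⟨r, hr, hball⟩ := Metric.isOpen_iff.1 hW _ hqW
  refine ⟨e.source ∩ e ⁻¹' Metric.ball (e q) r,
    (e.isOpen_inter_preimage Metric.isOpen_ball).mem_nhds ⟨hq, Metric.mem_ball_self hr⟩, ?_⟩
  intro a ha b hb hab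
  have hball' : ∀ v ∈ Metric.ball (e q).1 r, (v, ψ.proj a) ∈ Metric.ball (e q) r := by
    intro v hv
    rw [← Prod.mk.eta (p := e q), ← ball_prod_same]
    refine ⟨hv, ?_⟩
    have := ha.2
    rw [mem_preimage, ← Prod.mk.eta (p := e q), ← ball_prod_same] at this
    exact this.2
  have hmem : ∀ c ∈ e.source ∩ e ⁻¹' Metric.ball (e q) r, (e c).1 ∈ Metric.ball (e q).1 r := by
    intro c hc
    have := hc.2
    rw [mem_preimage, ← Prod.mk.eta (p := e q), ← ball_prod_same] at this
    exact this.1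
  have key := hψ'.proj_comp_eq (convex_ball (e q).1 r) (f := fun v => e.symm (v, ψ.proj a))
    (e.symm.continuousOn.comp (by fun_prop) fun v hv => (hball (hball' v hv)).1)
    (fun v hv => (hball (hball' v hv)).2) (hmem a ha) (hmem b hb)
  have h1 : e.symm ((e a).1, ψ.proj a) = a := e.left_inv ha.1
  have h2 : e.symm ((e b).1, ψ.proj a) = b := by
    rw [hab]
    exact e.left_inv hb.1
  simpa only [h1, h2] using key

end MatchboxManifold

end Matchbox

/-! ### Uniform constants from finiteness and compactness -/

theorem exists_pos_forall_of_finite {ι : Type*} [Finite ι] {P : ι → ℝ → Prop}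
    (hP : ∀ i r s, s ≤ r → P i r → P i s) (h : ∀ i, ∃ r > 0, P i r) : ∃ r > 0, ∀ i, P i r := by
  have hev : ∀ i, ∀ᶠ r in 𝓝[>] (0 : ℝ), P i r := fun i => by
    obtain ⟨r, hr, hPr⟩ := h i
    filter_upwards [Ioo_mem_nhdsGT hr] with s hs
    exact hP i r s hs.2.le hPr
  obtain ⟨r, hr, hr0⟩ := ((eventually_all.2 hev).and self_mem_nhdsWithin).exists
  exact ⟨r, hr0, hr⟩

/-- A Lebesgue number of the cover by the given neighbourhoods. -/
theorem IsCompact.exists_pos_forall_ball {M : Type*} [PseudoMetricSpace M] {K : Set M}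
    (hK : IsCompact K) {P : M → M → Prop}
    (hP : ∀ q ∈ K, ∃ V ∈ 𝓝 q, ∀ a ∈ V, ∀ b ∈ V, P a b) :
    ∃ r > 0, ∀ q ∈ K, ∀ a ∈ Metric.ball q r, ∀ b ∈ Metric.ball q r, P a b := by
  choose! V hV hVP using hP
  obtain ⟨r, hr, h⟩ := lebesgue_number_lemma_of_metric (c := fun q : K => interior (V q)) hK
    (fun _ => isOpen_interior)
    (fun q hq => mem_iUnion.2 ⟨⟨q, hq⟩, mem_interior_iff_mem_nhds.2 (hV q hq)⟩)
  refine ⟨r, hr, fun q hq a ha b hb => ?_⟩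
  obtain ⟨i, hi⟩ := h q hq
  exact hVP i i.2 a (interior_subset (hi ha)) b (interior_subset (hi hb))

/-- A map on a compact set which factors through another continuous map does so in a uniformly
continuous way. -/
theorem IsCompact.exists_pos_dist_lt_of_factors {M X Y : Type*} [TopologicalSpace M] [T2Space M]
    [MetricSpace X] [PseudoMetricSpace Y] {K : Set M} (hK : IsCompact K) {f : M → X} {g : M → Y}
    (hf : ContinuousOn f K) (hg : ContinuousOn g K)
    (hfg : ∀ a ∈ K, ∀ b ∈ K, f a = f b → g a = g b) {ρ : ℝ} (hρ : 0 < ρ) :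
    ∃ δ > 0, ∀ a ∈ K, ∀ b ∈ K, dist (f a) (f b) < δ → dist (g a) (g b) < ρ := by
  have hcf : ContinuousOn (fun p : M × M => dist (f p.1) (f p.2)) (K ×ˢ K) :=
    continuous_dist.comp_continuousOn ((hf.comp continuousOn_fst fun p hp => hp.1).prodMk
      (hf.comp continuousOn_snd fun p hp => hp.2))
  have hcg : ContinuousOn (fun p : M × M => dist (g p.1) (g p.2)) (K ×ˢ K) :=
    continuous_dist.comp_continuousOn ((hg.comp continuousOn_fst fun p hp => hp.1).prodMk
      (hg.comp continuousOn_snd fun p hp => hp.2))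
  have hKK := hK.prod hK
  -- On this compact set of pairs `dist (f a) (f b)` never vanishes, so its minimum serves as `δ`.
  set S := (K ×ˢ K) ∩ (fun p : M × M => dist (g p.1) (g p.2)) ⁻¹' Ici ρ
  have hS : IsCompact S := hKK.of_isClosed_subset
    (hcg.preimage_isClosed_of_isClosed hKK.isClosed isClosed_Ici) inter_subset_left
  obtain hSe | hSne := S.eq_empty_or_nonempty
  · refine ⟨1, one_pos, fun a ha b hb _ => ?_⟩
    by_contra! hcon
    exact (hSe ▸ (⟨⟨ha, hb⟩, hcon⟩ : (a, b) ∈ S) : (a, b) ∈ (∅ : Set (M × M)))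
  · obtain ⟨x, hx, hmin⟩ := hS.exists_isMinOn hSne (hcf.mono inter_subset_left)
    refine ⟨dist (f x.1) (f x.2), dist_pos.2 fun h => ?_, fun a ha b hb hab => ?_⟩
    · have h0 : ρ ≤ dist (g x.1) (g x.2) := hx.2
      rw [hfg _ hx.1.1 _ hx.1.2 h, dist_self] at h0
      exact absurd h0 (not_le.2 hρ)
    · by_contra! hcon
      exact absurd hab (not_lt.2 (hmin (a := (a, b)) ⟨⟨ha, hb⟩, hcon⟩))

/-! ### Equicontinuity of the holonomy -/

namespace Matchbox

namespace FoliationChart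

/-- The centre of the plaque over `w`. -/
def center {n : ℕ} {M X : Type*} [TopologicalSpace M] [TopologicalSpace X]
    (φ : FoliationChart n M X) (w : X) : M := φ.invFun (0, w)

theorem center_mem_source {n : ℕ} {M X : Type*} [TopologicalSpace M] [TopologicalSpace X]
    (φ : FoliationChart n M X) {w : X} (hw : w ∈ φ.model) : φ.center w ∈ φ.source :=
  φ.map_target' (φ.zero_mem_target hw)

theorem proj_center {n : ℕ} {M X : Type*} [TopologicalSpace M] [TopologicalSpace X]
    (φ : FoliationChart n M X) {w : X} (hw : w ∈ φ.model) : φ.proj (φ.center w) = w :=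
  φ.proj_invFun (φ.zero_mem_target hw)

theorem exists_pos_dist_center_lt {n : ℕ} {M X : Type*} [MetricSpace M] [MetricSpace X]
    (φ : FoliationChart n M X) {r : ℝ} (hr : 0 < r) :
    ∃ ρ > 0, ∀ w ∈ φ.model, ∀ w' ∈ φ.model, dist w w' < ρ →
      dist (φ.center w) (φ.center w') < r := by
  have hc : ContinuousOn φ.center φ.model :=
    φ.continuousOn_invFun.comp (by fun_prop) fun w hw => φ.zero_mem_target hw
  exact Metric.uniformContinuousOn_iff.1
    (φ.isCompact_model.uniformContinuousOn_of_continuous hc) r hr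

end FoliationChart

/-- A continuous map keeping a plaque inside a chart maps it into a plaque of that chart. -/
theorem MatchboxManifold.IsChart.proj_apply_center {n : ℕ} {M X : Type*} [TopologicalSpace M]
    [TopologicalSpace X] {𝔐 : MatchboxManifold n M X} {ψ φ : FoliationChart n M X}
    (hψ : 𝔐.IsChart ψ) {H : M → M} (hH : Continuous H) (hmaps : MapsTo H φ.source ψ.core) {z : M}
    (hz : z ∈ φ.source) : ψ.proj (H (φ.center (φ.proj z))) = ψ.proj (H z) := by
  have hT : ∀ v ∈ Icc (-1 : Fin n → ℝ) 1, (v, φ.proj z) ∈ φ.target := fun v hv =>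
    φ.mem_target.2 ⟨hv, φ.proj_mem_model hz⟩
  have h := hψ.proj_comp_eq (convex_Icc (-1 : Fin n → ℝ) 1)
    (f := fun v => H (φ.invFun (v, φ.proj z)))
    (hH.comp_continuousOn (φ.continuousOn_invFun.comp (by fun_prop) hT))
    (fun v hv => hmaps (φ.map_target' (hT v hv)))
    (φ.mem_target.1 (φ.zero_mem_target (φ.proj_mem_model hz))).1 (φ.leafCoord_mem_Icc hz)
  simpa only [FoliationChart.center, φ.invFun_coords hz] using h

namespace RegularCovering

variable {n : ℕ} {M X : Type*}

theorem transDomain_subset_model [TopologicalSpace M] [TopologicalSpace X]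
    {𝔐 : MatchboxManifold n M X} (C : RegularCovering 𝔐) (i j : Fin C.card) :
    C.transDomain i j ⊆ (C.chart i).model := by
  rintro _ ⟨z, hz, rfl⟩
  exact (C.chart i).proj_mem_model ((C.chart i).core_subset hz.1)

theorem chainDomain_subset_model [TopologicalSpace M] [TopologicalSpace X]
    {𝔐 : MatchboxManifold n M X} (C : RegularCovering 𝔐) (i : Fin C.card)
    (l : List (Fin C.card)) : C.chainDomain i l ⊆ (C.chart i).model := by
  cases l with
  | nil => exact C.transDomain_subset_model i i
  | cons j l => exact fun w hw => C.transDomain_subset_model i j hw.1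

/-- The holonomy of every regular covering of a homogeneous matchbox manifold is
equicontinuous. -/
theorem isEquicontinuous_of_isHomogeneousSpace [MetricSpace M] [CompactSpace M] [MetricSpace X]
    {𝔐 : MatchboxManifold n M X} (hM : IsHomogeneousSpace M) (C : RegularCovering 𝔐) :
    C.IsEquicontinuous := by
  intro ε hε
  let N : Fin C.card → Fin C.card → Prop := fun i j =>
    ((C.chart i).core ∩ (C.chart j).core).Nonempty
  choose ψ hψ hsub _ hinj using C.regular
  -- At scale `r` near the middle chart of a chain `i, j, k`, plaques of `ψ i j` lie in plaques of
  -- `ψ j k`.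
  obtain ⟨r, hr, hswitch⟩ := exists_pos_forall_of_finite
    (ι := {p : Fin C.card × Fin C.card × Fin C.card // N p.1 p.2.1 ∧ N p.2.1 p.2.2})
    (P := fun p r => ∀ q ∈ (C.chart p.1.2.1).source, ∀ a ∈ Metric.ball q r,
      ∀ b ∈ Metric.ball q r, (ψ _ _ p.2.1).proj a = (ψ _ _ p.2.1).proj b →
        (ψ _ _ p.2.2).proj a = (ψ _ _ p.2.2).proj b)
    (fun p r s hsr h q hq a ha b hb =>
      h q hq a (Metric.ball_subset_ball hsr ha) b (Metric.ball_subset_ball hsr hb))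
    (fun p => (C.chart p.1.2.1).isCompact_source.exists_pos_forall_ball fun q hq =>
      (hψ _ _ p.2.2).exists_nhds_proj_eq (hsub _ _ p.2.1 (Or.inr hq))
        (hsub _ _ p.2.2 (Or.inl hq)))
  obtain ⟨ρ₀, hρ₀, hcenter⟩ := exists_pos_forall_of_finite
    (P := fun (i : Fin C.card) ρ => ∀ w ∈ (C.chart i).model, ∀ w' ∈ (C.chart i).model,
      dist w w' < ρ → dist ((C.chart i).center w) ((C.chart i).center w') < r)
    (fun i r s hsr h w hw w' hw' hd => h w hw w' hw' (hd.trans_le hsr))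
    (fun i => (C.chart i).exists_pos_dist_center_lt hr)
  -- The bound carried along chains: `ε` is the goal, and `ρ₀` keeps centres within the range of
  -- `hswitch`.
  set ρ := min ρ₀ ε with hρdef
  have hρ : 0 < ρ := lt_min hρ₀ hε
  obtain ⟨ρ₁, hρ₁, htrans⟩ := exists_pos_forall_of_finite
    (ι := {p : Fin C.card × Fin C.card // N p.1 p.2})
    (P := fun p δ => ∀ a ∈ (C.chart p.1.2).source, ∀ b ∈ (C.chart p.1.2).source,
      dist ((ψ _ _ p.2).proj a) ((ψ _ _ p.2).proj b) < δ →
        dist ((C.chart p.1.2).proj a) ((C.chart p.1.2).proj b) < ρ)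
    (fun i r s hsr h a ha b hb hd => h a ha b hb (hd.trans_le hsr))
    (fun p => (C.chart p.1.2).isCompact_source.exists_pos_dist_lt_of_factors
      ((ψ _ _ p.2).continuousOn_proj.mono fun z hz =>
        (ψ _ _ p.2).core_subset (hsub _ _ p.2 (Or.inr hz)))
      (C.chart p.1.2).continuousOn_proj (hinj _ _ p.2) hρ)
  obtain ⟨ε₀, hε₀, hclose⟩ := exists_pos_forall_of_finite
    (ι := {p : Fin C.card × Fin C.card // N p.1 p.2})
    (P := fun p s => ∀ q ∈ (C.chart p.1.1).source ∪ (C.chart p.1.2).source,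
      ∀ a ∈ Metric.ball q s, ∀ b ∈ Metric.ball q s, a ∈ (ψ _ _ p.2).core ∧
        dist ((ψ _ _ p.2).proj a) ((ψ _ _ p.2).proj b) < ρ₁)
    (fun p r s hsr h q hq a ha b hb =>
      h q hq a (Metric.ball_subset_ball hsr ha) b (Metric.ball_subset_ball hsr hb))
    (fun p => ((C.chart p.1.1).isCompact_source.union
      (C.chart p.1.2).isCompact_source).exists_pos_forall_ball fun q hq => by
        have hqc := hsub _ _ p.2 hq
        have hnhds := (ψ _ _ p.2).isOpen_core.mem_nhds hqc
        have hcont : ContinuousAt (ψ _ _ p.2).proj q :=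
          ((ψ _ _ p.2).continuousOn_proj.mono (ψ _ _ p.2).core_subset).continuousAt hnhds
        refine ⟨_, inter_mem hnhds (hcont (Metric.ball_mem_nhds _ (half_pos hρ₁))), ?_⟩
        intro a ha b hb
        refine ⟨ha.1, ?_⟩
        calc _ ≤ _ := dist_triangle_right _ _ ((ψ _ _ p.2).proj q)
          _ < ρ₁ / 2 + ρ₁ / 2 := add_lt_add ha.2 hb.2
          _ = ρ₁ := add_halves ρ₁)
  set ε' := min ε₀ r with hε'def
  obtain ⟨δ', hδ', heffros⟩ :=
    Homeomorph.exists_apply_eq_of_dist_lt hM (ε := ε') (lt_min hε₀ hr)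
  obtain ⟨δ, hδ, hstart⟩ := exists_pos_forall_of_finite
    (P := fun (i : Fin C.card) ρ => ∀ w ∈ (C.chart i).model, ∀ w' ∈ (C.chart i).model,
      dist w w' < ρ → dist ((C.chart i).center w) ((C.chart i).center w') < δ')
    (fun i r s hsr h w hw w' hw' hd => h w hw w' hw' (hd.trans_le hsr))
    (fun i => (C.chart i).exists_pos_dist_center_lt hδ')
  -- The last hypothesis is the invariant: for every neighbour `j`, `h` sends the centre over `w`
  -- into the `ψ i j`-plaque of the centre over `w'`. The homeomorphism is fixed before the chain,
  -- so the constants do not depend on its length.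
  have hchain : ∀ h : M ≃ₜ M, (∀ z, dist (h z) z < ε') → ∀ (l : List (Fin C.card))
      (i : Fin C.card) (w w' : X), w ∈ C.chainDomain i l → w' ∈ C.chainDomain i l →
      dist w w' < ρ →
      (∀ j (hij : N i j), (ψ i j hij).proj (h ((C.chart i).center w)) =
        (ψ i j hij).proj ((C.chart i).center w')) →
      dist (C.chainMap i l w) (C.chainMap i l w') < ρ := by
    intro h hh l
    induction l with
    | nil => exact fun i w w' _ _ hd _ => hd
    | cons j l ih =>
      intro i w w' hw hw' hd hinv
      obtain ⟨⟨z, hz, rfl⟩, hwl⟩ := hw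
      obtain ⟨⟨z', hz', rfl⟩, hwl'⟩ := hw'
      have hij : N i j := ⟨z, hz⟩
      rw [C.transMap_proj hz] at hwl
      rw [C.transMap_proj hz'] at hwl'
      simp only [chainMap, C.transMap_proj hz, C.transMap_proj hz']
      have hclose' := hclose ⟨(i, j), hij⟩
      have hball : ∀ q, h q ∈ Metric.ball q ε₀ := fun q => (hh q).trans_le (min_le_left _ _)
      have hmaps : ∀ q ∈ (C.chart i).source ∪ (C.chart j).source, h q ∈ (ψ i j hij).core :=
        fun q hq => (hclose' q hq _ (hball q) _ (hball q)).1
      have hψij := hψ i j hij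
      have hzi := (C.chart i).core_subset hz.1
      have hzj := (C.chart j).core_subset hz.2
      have hzi' := (C.chart i).core_subset hz'.1
      have hzj' := (C.chart j).core_subset hz'.2
      have e1 := hψij.proj_apply_center h.continuous (fun q hq => hmaps q (Or.inl hq)) hzi
      have e2 := hψij.proj_apply_center h.continuous (fun q hq => hmaps q (Or.inr hq)) hzj
      have e3 := hψij.proj_apply_center continuous_id
        (fun q hq => hsub i j hij (Or.inl hq)) hzi'
      have e4 := hψij.proj_apply_center continuous_id
        (fun q hq => hsub i j hij (Or.inr hq)) hzj'
      simp only [id] at e3 e4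
      set q := (C.chart j).center ((C.chart j).proj z) with hq
      set q' := (C.chart j).center ((C.chart j).proj z') with hq'
      have hm := (C.chart j).proj_mem_model hzj
      have hm' := (C.chart j).proj_mem_model hzj'
      have hqs : q ∈ (C.chart j).source := (C.chart j).center_mem_source hm
      have hqs' : q' ∈ (C.chart j).source := (C.chart j).center_mem_source hm'
      -- The invariant passes from the centres in chart `i` to `z`, `z'` in the overlap, then to the
      -- centres in chart `j`.
      have hqq' : (ψ i j hij).proj (h q) = (ψ i j hij).proj q' := by
        rw [e2, ← e1, hinv j hij, e3, e4]
      -- The bound is obtained afresh from the displacement of `h` at `q`, not from the previous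
      -- distance `hd`.
      have hdist : dist ((C.chart j).proj z) ((C.chart j).proj z') < ρ := by
        have hlt := (hclose' q (Or.inr hqs) q (Metric.mem_ball_self hε₀) _ (hball q)).2
        rw [hqq'] at hlt
        have := htrans ⟨(i, j), hij⟩ q hqs q' hqs' hlt
        rwa [hq, hq', (C.chart j).proj_center hm, (C.chart j).proj_center hm'] at this
      refine ih j _ _ hwl hwl' hdist fun k hjk => ?_
      refine hswitch ⟨(i, j, k), hij, hjk⟩ q hqs (h q) ((hh q).trans_le (min_le_right _ _)) q' ?_
        hqq'
      rw [Metric.mem_ball, dist_comm]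
      exact hcenter j _ hm _ hm' (hdist.trans_le (min_le_left _ _))
  -- `δ` makes the centres close enough for Effros' theorem; `ρ` covers the empty chain.
  refine ⟨min δ ρ, lt_min hδ hρ, ?_⟩
  rintro g ⟨i, l, U, -, hU, rfl⟩ w w' hw hw' hd
  obtain ⟨h, hh, hc⟩ := heffros _ _ (hstart i w (C.chainDomain_subset_model i l (hU hw)) w'
    (C.chainDomain_subset_model i l (hU hw')) (hd.trans_le (min_le_left _ _)))
  exact (hchain h hh l i w w' (hU hw) (hU hw') (hd.trans_le (min_le_right _ _))
    fun j hij => by rw [hc]).trans_le (min_le_right _ _)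

end RegularCovering

end Matchbox

/-! ### Small charts and existence of regular coverings -/

namespace Matchbox

namespace FoliationChart

variable {n : ℕ} {M X : Type*}

theorem interior_Icc_prod [TopologicalSpace X] (T : Set X) :
    interior (Icc (-1 : Fin n → ℝ) 1 ×ˢ T) =
      (Set.pi univ fun _ => Ioo (-1) 1) ×ˢ interior T := by
  rw [interior_prod_eq, ← Set.pi_univ_Icc, interior_pi_set finite_univ]
  simp only [interior_Icc, Pi.neg_apply, Pi.one_apply]

theorem closure_pi_Ioo : closure (Set.pi univ fun _ : Fin n => Ioo (-1 : ℝ) 1) = Icc (-1) 1 := by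
  rw [closure_pi_set, ← Set.pi_univ_Icc]
  simp only [closure_Ioo (show (-1 : ℝ) ≠ 1 by norm_num), Pi.neg_apply, Pi.one_apply]

/-- The restriction of an open chart to a compact box in its target. -/
def ofOpenPartialHomeomorph [TopologicalSpace M] [T2Space M] [TopologicalSpace X]
    (e : OpenPartialHomeomorph M ((Fin n → ℝ) × X)) {T : Set X} (hT : IsCompact T)
    (hcl : closure (interior T) = T) (hsub : Icc (-1) 1 ×ˢ T ⊆ e.target) :
    FoliationChart n M X where
  toFun := e
  invFun := e.symm
  source := e.source ∩ e ⁻¹' (Icc (-1) 1 ×ˢ T)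
  target := Icc (-1) 1 ×ˢ T
  map_source' _ hz := hz.2
  map_target' p hp := ⟨e.map_target (hsub hp), by rwa [mem_preimage, e.right_inv (hsub hp)]⟩
  left_inv' _ hz := e.left_inv hz.1
  right_inv' _ hp := e.right_inv (hsub hp)
  model := T
  isCompact_model := hT
  target_eq := rfl
  continuousOn_toFun := e.continuousOn.mono inter_subset_left
  continuousOn_invFun := e.symm.continuousOn.mono hsub
  interior_source := by
    have h : interior (e.source ∩ e ⁻¹' (Icc (-1) 1 ×ˢ T)) =
        e.source ∩ e ⁻¹' interior (Icc (-1) 1 ×ˢ T) := by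
      rw [interior_inter, e.open_source.interior_eq, e.preimage_interior]
    rw [h, interior_Icc_prod, inter_assoc, ← preimage_inter]
    congr 2
    exact (inter_eq_right.2 (by
      rw [← interior_Icc_prod]
      exact interior_subset)).symm
  closure_interior := by
    have h : interior (e.source ∩ e ⁻¹' (Icc (-1) 1 ×ˢ T)) =
        e.source ∩ e ⁻¹' interior (Icc (-1) 1 ×ˢ T) := by
      rw [interior_inter, e.open_source.interior_eq, e.preimage_interior]
    have himage : e.symm '' (Icc (-1) 1 ×ˢ T) = e.source ∩ e ⁻¹' (Icc (-1) 1 ×ˢ T) :=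
      e.symm_image_eq_source_inter_preimage hsub
    have hclosed : IsClosed (e.source ∩ e ⁻¹' (Icc (-1) 1 ×ˢ T)) := by
      rw [← himage]
      exact ((isCompact_Icc.prod hT).image_of_continuousOn
        (e.symm.continuousOn.mono hsub)).isClosed
    -- The box is the closure of its interior, and `e.symm` carries this density back to `M`.
    refine (closure_minimal interior_subset hclosed).antisymm fun z hz => ?_
    have hQ : e z ∈ closure (interior (Icc (-1 : Fin n → ℝ) 1 ×ˢ T)) := by
      rw [interior_Icc_prod, closure_prod_eq, closure_pi_Ioo, hcl]
      exact hz.2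
    have hz' := mem_closure_image (e.symm.continuousAt (hsub hz.2)) hQ
    rw [e.left_inv hz.1] at hz'
    refine closure_mono ?_ hz'
    rw [h, e.symm_image_eq_source_inter_preimage (interior_subset.trans hsub)]

section Rescale

variable [TopologicalSpace M] [TopologicalSpace X] {χ φ φ' : FoliationChart n M X} {s : ℝ}

theorem SmoothCompatible.rescale_right (h : χ.SmoothCompatible φ) (hcore : φ'.core ⊆ φ.core)
    (hproj : ∀ z, φ'.proj z = φ.proj z) (hleaf : ∀ z, φ'.leafCoord z = s⁻¹ • φ.leafCoord z) :
    χ.SmoothCompatible φ' := by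
  have htrans : ∀ w, χ.leafTransition φ' w = s⁻¹ • χ.leafTransition φ w := fun w =>
    funext fun v => hleaf _
  have hsub : χ.core ∩ φ'.core ⊆ χ.core ∩ φ.core := inter_subset_inter_right _ hcore
  refine ⟨fun z hz => ?_, fun z hz => ?_, fun k => ?_⟩
  · simpa only [hproj] using h.1 z (hsub hz)
  · rw [htrans]
    exact (h.2.1 z (hsub hz)).const_smul s⁻¹
  · refine (((h.2.2 k).mono hsub).const_smul s⁻¹).congr fun z hz => ?_
    simp only [htrans]
    exact iteratedFDeriv_const_smul_apply ((h.2.1 z (hsub hz)).of_le (by exact_mod_cast le_top))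

/-- The transition is precomposed with the linear isomorphism `s •`, so its derivatives change by a
fixed continuous operation on multilinear maps. -/
theorem SmoothCompatible.rescale_left (hs : s ≠ 0) (h : φ.SmoothCompatible χ)
    (hcore : φ'.core ⊆ φ.core) (hproj : ∀ z, φ'.proj z = φ.proj z)
    (hleaf : ∀ z, φ'.leafCoord z = s⁻¹ • φ.leafCoord z)
    (hinv : ∀ v w, φ'.invFun (v, w) = φ.invFun (s • v, w)) :
    φ'.SmoothCompatible χ := by
  let L : (Fin n → ℝ) ≃L[ℝ] (Fin n → ℝ) := ContinuousLinearEquiv.smulLeft (Units.mk0 s hs)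
  have hL : ∀ z, L (φ'.leafCoord z) = φ.leafCoord z := fun z => by
    rw [hleaf]
    exact smul_inv_smul₀ hs _
  have htrans : ∀ w, φ'.leafTransition χ w = φ.leafTransition χ w ∘ L := fun w =>
    funext fun v => congrArg χ.leafCoord (hinv v w)
  have hsub : φ'.core ∩ χ.core ⊆ φ.core ∩ χ.core := inter_subset_inter_left _ hcore
  refine ⟨fun z hz => ?_, fun z hz => ?_, fun k => ?_⟩
  · simpa only [hproj] using h.1 z (hsub hz)
  · rw [htrans, hproj]
    refine ContDiffAt.comp _ ?_ L.contDiff.contDiffAt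
    rw [hL]
    exact h.2.1 z (hsub hz)
  · have hc := (ContinuousMultilinearMap.compContinuousLinearMapL (𝕜 := ℝ) (F := Fin n → ℝ)
      (fun _ : Fin k => (L : (Fin n → ℝ) →L[ℝ] (Fin n → ℝ)))).continuous.comp_continuousOn
      ((h.2.2 k).mono hsub)
    refine hc.congr fun z hz => ?_
    simp only [htrans, hproj, Function.comp_apply]
    have := L.iteratedFDerivWithin_comp_right (φ.leafTransition χ (φ.proj z)) uniqueDiffOn_univ
      (mem_univ (L (φ'.leafCoord z))) k
    rw [preimage_univ, iteratedFDerivWithin_univ, iteratedFDerivWithin_univ, hL] at this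
    exact this

end Rescale

end FoliationChart

namespace MatchboxManifold

variable {n : ℕ} {M X : Type*}

theorem isChart_chart [TopologicalSpace M] [TopologicalSpace X] (𝔐 : MatchboxManifold n M X)
    (x : M) : 𝔐.IsChart (𝔐.chart x) := fun y => ⟨𝔐.compatible y x, 𝔐.compatible x y⟩

/-- Every point is the centre of arbitrarily small charts with the same plaques as its chart in
the atlas. -/
theorem exists_isChart_source_subset [TopologicalSpace M] [T2Space M] [MetricSpace X]
    [CompactSpace X] (𝔐 : MatchboxManifold n M X) (x : M) {V : Set M} (hV : V ∈ 𝓝 x) :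
    ∃ φ : FoliationChart n M X, 𝔐.IsChart φ ∧ x ∈ φ.core ∧ φ.leafCoord x = 0 ∧ φ.source ⊆ V ∧
      ∀ z, φ.proj z = (𝔐.chart x).proj z := by
  set χ := 𝔐.chart x with hχ
  set e := χ.toOpenPartialHomeomorph with he
  have hx : x ∈ e.source := 𝔐.mem_core x
  have hex : e x = (0, χ.proj x) := Prod.ext (𝔐.leafCoord_center x) rfl
  obtain ⟨r, hr, hball⟩ := Metric.isOpen_iff.1
    (e.symm.isOpen_inter_preimage (isOpen_interior (s := V))) (e x) ⟨e.map_source hx, by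
      rw [mem_preimage, e.left_inv hx]
      exact mem_interior_iff_mem_nhds.2 hV⟩
  set s := r / 2 with hsdef
  have hs : 0 < s := half_pos hr
  have hsr : s < r := half_lt_self hr
  -- The closure of an open ball is the closure of its interior; a closed ball may fail to be.
  set T := closure (Metric.ball (χ.proj x) s) with hT
  have hTc : IsCompact T := isClosed_closure.isCompact
  have hTcl : closure (interior T) = T :=
    (closure_minimal interior_subset isClosed_closure).antisymm
      (closure_mono (interior_maximal subset_closure Metric.isOpen_ball))
  let A : (Fin n → ℝ) × X ≃ₜ (Fin n → ℝ) × X :=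
    (Homeomorph.smulOfNeZero s hs.ne').prodCongr (Homeomorph.refl X)
  have hA : ∀ p ∈ Icc (-1 : Fin n → ℝ) 1 ×ˢ T, A p ∈ Metric.ball (e x) r := by
    rintro ⟨v, w⟩ ⟨hv, hw⟩
    rw [hex, ← ball_prod_same]
    refine ⟨?_, Metric.closedBall_subset_ball hsr (Metric.closure_ball_subset_closedBall hw)⟩
    have hv1 : ‖v‖ ≤ 1 := (pi_norm_le_iff_of_nonneg zero_le_one).2 fun k =>
      abs_le.2 ⟨hv.1 k, hv.2 k⟩
    have : ‖s • v‖ ≤ s := by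
      rw [norm_smul, Real.norm_of_nonneg hs.le]
      exact mul_le_of_le_one_right hs.le hv1
    exact mem_ball_zero_iff.2 (this.trans_lt hsr)
  set e' := e.transHomeomorph A.symm with he'
  have hsub : Icc (-1 : Fin n → ℝ) 1 ×ˢ T ⊆ e'.target := fun p hp => (hball (hA p hp)).1
  set φ := FoliationChart.ofOpenPartialHomeomorph e' hTc hTcl hsub with hφ
  have hproj : ∀ z, φ.proj z = χ.proj z := fun z => rfl
  have hleaf : ∀ z, φ.leafCoord z = s⁻¹ • χ.leafCoord z := fun z => rfl
  have hinv : ∀ v w, φ.invFun (v, w) = χ.invFun (s • v, w) := fun v w => rfl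
  have hcore : φ.core ⊆ χ.core := fun z hz => (φ.core_subset hz).1
  have hx0 : φ.toFun x = (0, χ.proj x) := by
    refine Prod.ext ?_ rfl
    have h1 := hleaf x
    rw [show χ.leafCoord x = 0 from 𝔐.leafCoord_center x, smul_zero] at h1
    exact h1
  have hxT : χ.proj x ∈ interior T :=
    interior_maximal subset_closure Metric.isOpen_ball (Metric.mem_ball_self hs)
  have h0 : (0 : Fin n → ℝ) ∈ Set.pi univ fun _ : Fin n => Ioo (-1 : ℝ) 1 := fun k _ => by simp
  refine ⟨φ, fun y => ⟨(𝔐.compatible y x).rescale_right hcore hproj hleaf,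
    (𝔐.compatible x y).rescale_left hs.ne' hcore hproj hleaf hinv⟩, ?_,
    congrArg Prod.fst hx0, fun z hz => ?_, hproj⟩
  · rw [φ.core_eq]
    refine ⟨⟨hx, ?_⟩, ?_⟩
    · have : e' x = (0, χ.proj x) := hx0
      rw [mem_preimage, this]
      exact ⟨⟨fun k => by simp, fun k => by simp⟩, interior_subset hxT⟩
    · rw [mem_preimage, hx0]
      exact ⟨h0, hxT⟩
  · have h1 := (hball (hA _ hz.2)).2
    have h2 : A (e' z) = e z := A.apply_symm_apply _
    rw [mem_preimage, h2, e.left_inv hz.1] at h1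
    exact interior_subset h1

/-- A compact matchbox manifold has regular coverings by arbitrarily small centred charts. -/
theorem exists_regularCovering_isLocal [MetricSpace M] [CompactSpace M] [MetricSpace X]
    [CompactSpace X] (𝔐 : MatchboxManifold n M X) {η : ℝ} (hη : 0 < η) :
    ∃ C : RegularCovering 𝔐, C.IsLocal η := by
  obtain ⟨F, -, hF⟩ := (isCompact_univ (X := M)).elim_nhds_subcover
    (fun y => (𝔐.chart y).core) fun y _ => (𝔐.chart y).isOpen_core.mem_nhds (𝔐.mem_core y)
  obtain ⟨r, hr, hleb⟩ := lebesgue_number_lemma_of_metric (isCompact_univ (X := M))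
    (c := fun y : F => (𝔐.chart y).core) (fun y => (𝔐.chart y).isOpen_core) (fun z hz => by
      obtain ⟨y, hy, hzy⟩ := mem_iUnion₂.1 (hF hz)
      exact mem_iUnion.2 ⟨⟨y, hy⟩, hzy⟩)
  -- Only finitely many `y` occur, so these neighbourhoods of `q` can be intersected.
  have hV : ∀ q, ∀ y : F, ∃ V ∈ 𝓝 q, q ∈ (𝔐.chart y).core → ∀ a ∈ V, ∀ b ∈ V,
      (𝔐.chart y).proj a = (𝔐.chart y).proj b → (𝔐.chart q).proj a = (𝔐.chart q).proj b := by
    intro q y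
    by_cases hq : q ∈ (𝔐.chart y).core
    · obtain ⟨V, hV, h⟩ := (𝔐.isChart_chart q).exists_nhds_proj_eq hq (𝔐.mem_core q)
      exact ⟨V, hV, fun _ => h⟩
    · exact ⟨univ, univ_mem, fun h => absurd h hq⟩
  choose V hVn hVp using hV
  choose φ hφ hmem hzero hsource hproj using fun q => 𝔐.exists_isChart_source_subset q
    (inter_mem (iInter_mem.2 (hVn q))
      (Metric.ball_mem_nhds q (lt_min hη (show 0 < r / 4 by positivity))))
  have hsmall : ∀ q, ∀ z ∈ (φ q).source, dist z q < r / 4 := fun q z hz =>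
    (hsource q hz).2.trans_le (min_le_right _ _)
  have hplaque : ∀ q, ∀ y : F, q ∈ (𝔐.chart y).core → ∀ a ∈ (φ q).source, ∀ b ∈ (φ q).source,
      (𝔐.chart y).proj a = (𝔐.chart y).proj b → (φ q).proj a = (φ q).proj b := by
    intro q y hq a ha b hb hab
    rw [hproj, hproj]
    exact hVp q y hq a (mem_iInter.1 (hsource q ha).1 y) b (mem_iInter.1 (hsource q hb).1 y) hab
  obtain ⟨t, -, ht⟩ := (isCompact_univ (X := M)).elim_nhds_subcover
    (fun q => (φ q).core) fun q _ => (φ q).isOpen_core.mem_nhds (hmem q)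
  let x : Fin t.card → M := fun i => t.equivFin.symm i
  let C : RegularCovering 𝔐 :=
    { card := t.card
      chart := fun i => φ (x i)
      isChart := fun i => hφ _
      cover := fun z => by
        obtain ⟨q, hq, hzq⟩ := mem_iUnion₂.1 (ht (mem_univ z))
        refine ⟨t.equivFin ⟨q, hq⟩, ?_⟩
        simpa only [x, Equiv.symm_apply_apply] using hzq
      regular := by
        rintro i j ⟨z, hzi, hzj⟩
        -- If the two charts meet, points of both are within `3 * (r / 4) < r` of `x i`, so one
        -- atlas chart contains both.
        obtain ⟨y, hy⟩ := hleb (x i) trivial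
        have h1 := hsmall (x i) z ((φ (x i)).core_subset hzi)
        have h2 := hsmall (x j) z ((φ (x j)).core_subset hzj)
        have hj : ∀ b ∈ (φ (x j)).source, b ∈ (𝔐.chart y).core := fun b hb => hy (by
          have h3 := hsmall (x j) b hb
          have h4 := dist_triangle_right b z (x j)
          have h5 := dist_triangle b z (x i)
          rw [Metric.mem_ball]
          linarith)
        have hi : ∀ a ∈ (φ (x i)).source, a ∈ (𝔐.chart y).core := fun a ha => hy (by
          have h3 := hsmall (x i) a ha
          rw [Metric.mem_ball]
          linarith)
        have hxi := hi _ ((φ (x i)).core_subset (hmem (x i)))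
        have hxj := hj _ ((φ (x j)).core_subset (hmem (x j)))
        exact ⟨𝔐.chart y, 𝔐.isChart_chart y, union_subset hi hj, hplaque _ y hxi,
          hplaque _ y hxj⟩ }
  exact ⟨C, fun i => ⟨x i, hmem _, hzero _, fun z hz =>
    Metric.ball_subset_ball (min_le_left _ _) (hsource _ hz).2⟩⟩

end MatchboxManifold

end Matchbox

theorem theorem5p2 {n : ℕ} {M X : Type*} [MetricSpace M] [CompactSpace M] [ConnectedSpace M]
    [MetricSpace X] [CompactSpace X] (𝔐 : Matchbox.MatchboxManifold n M X)
    (hM : Matchbox.IsHomogeneousSpace M) :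
    𝔐.IsEquicontinuous ∧
    (∀ η > 0, ∃ C : Matchbox.RegularCovering 𝔐, C.IsLocal η) ∧
    ∀ C : Matchbox.RegularCovering 𝔐, C.IsEquicontinuous := by
  have hC := Matchbox.RegularCovering.isEquicontinuous_of_isHomogeneousSpace (𝔐 := 𝔐) hM
  obtain ⟨C, -⟩ := 𝔐.exists_regularCovering_isLocal one_pos
  exact ⟨⟨C, hC C⟩, fun η hη => 𝔐.exists_regularCovering_isLocal hη, hC⟩
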